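/- Two senders compete for two receivers. Fix a prior $\lambda\in(0,1)$ and $v:\{0,1,2\}\to\mathbb{R}$ with $v(0)=0$, $v$ strictly increasing and strictly concave (that is, $v(2)-v(1)<v(1)-v(0)$). A sender who wins the set $S\subseteq\{1,2\}$ of receivers gets $V(S)=v(|S|)$ (an anonymous strictly submodular utility). A signaling policy is a Borel probability measure $G$ on $[0,1]^2$ that is Bayes-plausible: $\int q_j\,dG(q)=\lambda$ for $j=1,2$. When the senders use policies $G$ and $F$, signals $q\sim G$ and $p\sim F$ are drawn independently; receiver $j$ selects the sender with the larger of $q_j,p_j$, and ties are broken by independent fair coins. Let $U(G,F)$ be the expected utility of the sender using $G$ against $F$, and $\mathrm{WEL}(G,F)=U(G,F)+U(F,G)$. The pair $(G,F)$ is an equilibrium if each policy is a best response to the other among all signaling policies. Let $\mathrm{OPT}=\max_{S\subseteq\{1,2\}}\bigl(V(S)+V(\{1,2\}\setminus S)\bigr)$, and let the price of stability be $$\Gamma(\lambda,v)=\frac{\mathrm{OPT}}{\sup\{\mathrm{WEL}(G,G): (G,G)\text{ an equilibrium}\}}\in[0,\infty],$$ where the supremum of the empty set is $0$ and $\mathrm{OPT}/0=\infty$.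 Then: 1. If $\lambda\le 1/2$, then $\Gamma(\lambda,v)=1$. Moreover, if $G$ is the uniform distribution on the segment $\{(q_1,q_2)\in[0,1]^2: q_1+q_2=2\lambda,\ 0\le q_1\le 2\lambda\}$, then $(G,G)$ is an equilibrium with $\mathrm{WEL}(G,G)=\mathrm{OPT}$. 2. If $\lambda>1/2$, then $\Gamma(\lambda,v)>1$. 3. For every $\lambda\in(0,1)$: if $(G,G)$ is an equilibrium with $\mathrm{WEL}(G,G)=\mathrm{OPT}$, then the support of $G$ is a line segment from $(0,b)$ to $(a,0)$ for some $a,b\in(0,1]$. 4. If $\lambda>1/2$, then no Bayes-plausible $G$ has its support contained in a line segment from $(0,b)$ to $(a,0)$ with $a,b\in(0,1]$. -/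

import Mathlib

open MeasureTheory ProbabilityTheory
open scoped ENNReal

/-- Probability that a receiver selects the sender whose realized posterior mean is `q` when the
other sender's realized posterior mean is `p`; a tie is broken by a fair coin. -/
noncomputable def winProb (q p : ℝ) : ℝ :=
  if p < q then 1 else if p = q then 1 / 2 else 0

/-- Probability that the sender with realized signal `q` wins exactly the set `S` of receivers
against the realized signal `p`; ties of distinct receivers are broken independently. -/
noncomputable def winSetProb {n : ℕ} (q p : Fin n → ℝ) (S : Finset (Fin n)) : ℝ :=
  (∏ j ∈ S, winProb (q j) (p j)) * ∏ j ∈ Sᶜ, (1 - winProb (q j) (p j))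

/-- Probability that the sender with realized signal `q` wins exactly the set `S` of receivers
when the other sender uses the signaling policy `F`. -/
noncomputable def winSetProbAgainst {n : ℕ} (q : Fin n → ℝ) (S : Finset (Fin n))
    (F : Measure (Fin n → ℝ)) : ℝ :=
  ∫ p, winSetProb q p S ∂F

/-- Expected utility of a sender with realized signal `q` when the other sender uses `F`. -/
noncomputable def interimUtility {n : ℕ} (V : Finset (Fin n) → ℝ) (q : Fin n → ℝ)
    (F : Measure (Fin n → ℝ)) : ℝ :=
  ∑ S : Finset (Fin n), winSetProbAgainst q S F * V S

/-- Expected utility of a sender who uses `G` when the other sender uses `F`. -/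
noncomputable def expectedUtility {n : ℕ} (V : Finset (Fin n) → ℝ)
    (G F : Measure (Fin n → ℝ)) : ℝ :=
  ∫ q, interimUtility V q F ∂G

/-- A signaling policy for the prior `lam`: a joint distribution on `[0,1]ⁿ` of the receivers'
posterior means that is Bayes-plausible, i.e. every marginal has mean `lam`. -/
structure IsSignalingPolicy {n : ℕ} (lam : ℝ) (G : Measure (Fin n → ℝ)) : Prop where
  isProbabilityMeasure : IsProbabilityMeasure G
  mem_cube : ∀ᵐ q ∂G, ∀ j, q j ∈ Set.Icc (0 : ℝ) 1
  bayesPlausible : ∀ j, ∫ q, q j ∂G = lam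

/-- `G` is a best response to `F` among all signaling policies for the prior `lam`. -/
def IsBestResponse {n : ℕ} (V : Finset (Fin n) → ℝ) (lam : ℝ)
    (G F : Measure (Fin n → ℝ)) : Prop :=
  IsSignalingPolicy lam G ∧
    ∀ G' : Measure (Fin n → ℝ), IsSignalingPolicy lam G' →
      expectedUtility V G' F ≤ expectedUtility V G F

/-- `(G, F)` is a pure-strategy Nash equilibrium. -/
def IsEquilibrium {n : ℕ} (V : Finset (Fin n) → ℝ) (lam : ℝ)
    (G F : Measure (Fin n → ℝ)) : Prop :=
  IsBestResponse V lam G F ∧ IsBestResponse V lam F G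

/-- The senders' welfare: the sum of the two senders' expected utilities. -/
noncomputable def welfare {n : ℕ} (V : Finset (Fin n) → ℝ) (G F : Measure (Fin n → ℝ)) : ℝ :=
  expectedUtility V G F + expectedUtility V F G

/-- The welfare of an optimal outcome: the maximum over `S` of `V S + V Sᶜ`. -/
noncomputable def optimalWelfare {n : ℕ} (V : Finset (Fin n) → ℝ) : ℝ :=
  (Finset.univ : Finset (Finset (Fin n))).sup' Finset.univ_nonempty (fun S => V S + V Sᶜ)

/-- The price of stability: the optimal welfare divided by the best welfare of a symmetric
equilibrium. It takes values in `[0, ∞]`, and the best welfare is a supremum, so that nothing about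
the existence of equilibria or of a best one is built in. -/
noncomputable def priceOfStability {n : ℕ} (V : Finset (Fin n) → ℝ) (lam : ℝ) : ℝ≥0∞ :=
  ENNReal.ofReal (optimalWelfare V) /
    ⨆ (G : Measure (Fin n → ℝ)) (_ : IsEquilibrium V lam G G), ENNReal.ofReal (welfare V G G)

/-- The anonymous utility function on sets of `n` receivers that is given by `v`. -/
def anonymousUtility (n : ℕ) (v : ℕ → ℝ) (S : Finset (Fin n)) : ℝ :=
  v S.card

/-- `v` is strictly concave on `{0, 1, …, n}`: its increments there strictly decrease. -/
def IsStrictlyConcaveUpTo (n : ℕ) (v : ℕ → ℝ) : Prop :=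
  ∀ k : ℕ, k + 2 ≤ n → v (k + 2) - v (k + 1) < v (k + 1) - v k

/-- The uniform distribution on the segment `{(q₁, q₂) ∈ [0,∞)² : q₁ + q₂ = 2 lam}`. -/
noncomputable def uniformOnLine (lam : ℝ) : Measure (Fin 2 → ℝ) :=
  ((volume : Measure ℝ)[|Set.Icc 0 (2 * lam)]).map (fun t => ![t, 2 * lam - t])

/-! ### The winning probability -/

/-! Put `c = 2 * v 1 - v 2`. Strict concavity and strict monotonicity say `0 < c < v 1`, and the
optimum is `2 * v 1`, one receiver each. A sender who wins the receivers with probabilities `x`, `y`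
earns `v₁ (x + y) - c x y`. Adding the other sender's payoff shows that welfare is `2 * v 1` minus
`c` times the probability that one sender sweeps both receivers. So `G` against itself is optimal
exactly when two independent draws are almost surely ordered in opposite directions
(`welfare_self_eq_iff`).

For `lam ≤ 1/2`, the uniform law on the antidiagonal has this property. Against it, signal `q j`
wins `j` with probability at most `q j / (2 * lam)`, so each policy earns at most `v 1` by
Bayes-plausibility; this is what the uniform law earns against itself.

For `lam > 1/2`, mix the signals `(0,1)`, `(1,0)`, `(1,1)` with weights `1 - lam`, `1 - lam`, `2 *
lam - 1`. Barring ties at `1`, this earns `v 1 + (2 * lam - 1) * (v 2 - v 1)`, while a symmetric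
equilibrium earns at most `v 1`. Hence an equilibrium policy puts mass bounded below on signals with
some coordinate `1`; two such draws tie there, and ties cost welfare (`exists_welfare_gap`).

For the support, Hahn–Banach puts an affine function above the interim utility, with equilibrium
value at the prior (`exists_affine_majorant`). In an optimal equilibrium the two agree almost
everywhere, so `G` lives on a line, which is decreasing. A gap in the support would leave room for a
signal below the line that still earns `v 1`, above the majorant. -/

lemma winProb_nonneg (q p : ℝ) : 0 ≤ winProb q p := by
  unfold winProb; split_ifs <;> norm_num

lemma winProb_le_one (q p : ℝ) : winProb q p ≤ 1 := by
  unfold winProb; split_ifs <;> norm_num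

lemma winProb_of_lt {q p : ℝ} (h : p < q) : winProb q p = 1 := by
  simp [winProb, h]

lemma winProb_of_gt {q p : ℝ} (h : q < p) : winProb q p = 0 := by
  simp [winProb, h.le, h.ne']

lemma winProb_self (q : ℝ) : winProb q q = 1 / 2 := by
  simp [winProb]

lemma winProb_swap (q p : ℝ) : winProb p q = 1 - winProb q p := by
  rcases lt_trichotomy q p with h | rfl | h
  · rw [winProb_of_lt h, winProb_of_gt h]; norm_num
  · rw [winProb_self]; norm_num
  · rw [winProb_of_lt h, winProb_of_gt h]; norm_num

lemma winProb_le_indicator (q p : ℝ) : winProb q p ≤ (Set.Iic q).indicator 1 p := by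
  by_cases h : p ≤ q
  · simpa [h] using winProb_le_one q p
  · rw [winProb_of_gt (not_le.1 h)]; simp [h]

lemma measurable_winProb : Measurable (fun z : ℝ × ℝ => winProb z.1 z.2) := by
  unfold winProb
  refine Measurable.ite (measurableSet_lt measurable_snd measurable_fst) measurable_const ?_
  exact Measurable.ite (measurableSet_eq_fun measurable_snd measurable_fst)
    measurable_const measurable_const

lemma Measurable.winProb {X : Type*} [MeasurableSpace X] {f g : X → ℝ} (hf : Measurable f)
    (hg : Measurable g) : Measurable (fun x => winProb (f x) (g x)) :=
  measurable_winProb.comp (hf.prodMk hg)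

/-! ### Payoffs for two receivers -/

/-- The payoff from the realized signals `q` against `p` for two receivers, when the utility is
`v₁` for one receiver and `2 * v₁ - c` for both. -/
noncomputable def payoff (v₁ c : ℝ) (q p : Fin 2 → ℝ) : ℝ :=
  v₁ * (winProb (q 0) (p 0) + winProb (q 1) (p 1)) -
    c * (winProb (q 0) (p 0) * winProb (q 1) (p 1))

/-- The probability that one sender wins both receivers. -/
noncomputable def sweepProb (q p : Fin 2 → ℝ) : ℝ :=
  winProb (q 0) (p 0) * winProb (q 1) (p 1) +
    (1 - winProb (q 0) (p 0)) * (1 - winProb (q 1) (p 1))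

lemma measurable_payoff (v₁ c : ℝ) :
    Measurable (fun z : (Fin 2 → ℝ) × (Fin 2 → ℝ) => payoff v₁ c z.1 z.2) := by
  unfold payoff
  have h (j : Fin 2) : Measurable
      (fun z : (Fin 2 → ℝ) × (Fin 2 → ℝ) => winProb (z.1 j) (z.2 j)) :=
    Measurable.winProb (by fun_prop) (by fun_prop)
  exact (((h 0).add (h 1)).const_mul _).sub (((h 0).mul (h 1)).const_mul _)

lemma measurable_sweepProb :
    Measurable (fun z : (Fin 2 → ℝ) × (Fin 2 → ℝ) => sweepProb z.1 z.2) := by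
  unfold sweepProb
  have h (j : Fin 2) : Measurable
      (fun z : (Fin 2 → ℝ) × (Fin 2 → ℝ) => winProb (z.1 j) (z.2 j)) :=
    Measurable.winProb (by fun_prop) (by fun_prop)
  exact ((h 0).mul (h 1)).add (((h 0).const_sub _).mul ((h 1).const_sub _))

lemma payoff_nonneg {v₁ c : ℝ} (hc0 : 0 ≤ c) (hc : c ≤ v₁) (q p : Fin 2 → ℝ) :
    0 ≤ payoff v₁ c q p := by
  unfold payoff
  have h0 := winProb_nonneg (q 0) (p 0)
  have h0' := winProb_le_one (q 0) (p 0)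
  have h1 := winProb_nonneg (q 1) (p 1)
  nlinarith [mul_nonneg hc0 (mul_nonneg h1 (sub_nonneg.2 h0')), mul_nonneg (hc0.trans hc) h0,
    mul_nonneg (sub_nonneg.2 hc) h1]

lemma payoff_le {v₁ c : ℝ} (hc0 : 0 ≤ c) (q p : Fin 2 → ℝ) :
    payoff v₁ c q p ≤ v₁ * (winProb (q 0) (p 0) + winProb (q 1) (p 1)) := by
  unfold payoff
  have := mul_nonneg hc0 (mul_nonneg (winProb_nonneg (q 0) (p 0)) (winProb_nonneg (q 1) (p 1)))
  linarith

lemma payoff_le_two_mul {v₁ c : ℝ} (hc0 : 0 ≤ c) (hc : c ≤ v₁) (q p : Fin 2 → ℝ) :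
    payoff v₁ c q p ≤ 2 * v₁ := by
  have h0' := winProb_le_one (q 0) (p 0)
  have h1' := winProb_le_one (q 1) (p 1)
  nlinarith [payoff_le (v₁ := v₁) hc0 q p]

/-- The source of all welfare statements: the only loss against `2 * v₁` comes from sweeps, at price
`c`. -/
lemma payoff_add_payoff_swap (v₁ c : ℝ) (q p : Fin 2 → ℝ) :
    payoff v₁ c q p + payoff v₁ c p q = 2 * v₁ - c * sweepProb q p := by
  unfold payoff sweepProb
  rw [winProb_swap (q 0) (p 0), winProb_swap (q 1) (p 1)]
  ring

lemma sweepProb_nonneg (q p : Fin 2 → ℝ) : 0 ≤ sweepProb q p := by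
  unfold sweepProb
  have h0 := winProb_nonneg (q 0) (p 0)
  have h0' := winProb_le_one (q 0) (p 0)
  have h1 := winProb_nonneg (q 1) (p 1)
  have h1' := winProb_le_one (q 1) (p 1)
  exact add_nonneg (mul_nonneg h0 h1) (mul_nonneg (sub_nonneg.2 h0') (sub_nonneg.2 h1'))

lemma sweepProb_le_two (q p : Fin 2 → ℝ) : sweepProb q p ≤ 2 := by
  unfold sweepProb
  have h0 := winProb_nonneg (q 0) (p 0)
  have h0' := winProb_le_one (q 0) (p 0)
  have h1 := winProb_nonneg (q 1) (p 1)
  have h1' := winProb_le_one (q 1) (p 1)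
  nlinarith

/-- A fair coin at one receiver matches the outcome at the other with probability `1 / 2`, whatever
that outcome is. -/
lemma sweepProb_of_tie {q p : Fin 2 → ℝ} {j : Fin 2} (h : q j = p j) :
    sweepProb q p = 1 / 2 := by
  unfold sweepProb
  fin_cases j
  · simp only [Fin.zero_eta] at h
    rw [h, winProb_self]; ring
  · simp only [Fin.mk_one] at h
    rw [h, winProb_self]; ring

/-- The two signals are strictly ordered in opposite directions at the two receivers. -/
def StrictlyOpposed (q p : Fin 2 → ℝ) : Prop :=
  (p 0 < q 0 ∧ q 1 < p 1) ∨ (q 0 < p 0 ∧ p 1 < q 1)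

lemma sweepProb_eq_zero_iff {q p : Fin 2 → ℝ} : sweepProb q p = 0 ↔ StrictlyOpposed q p := by
  unfold sweepProb StrictlyOpposed
  rcases lt_trichotomy (q 0) (p 0) with h | h | h <;>
  rcases lt_trichotomy (q 1) (p 1) with h' | h' | h' <;>
  simp [winProb_of_lt, winProb_of_gt, winProb_self, h, h', h.not_gt, h'.not_gt] <;>
  norm_num

lemma StrictlyOpposed.payoff_eq {q p : Fin 2 → ℝ} (h : StrictlyOpposed q p) (v₁ c : ℝ) :
    payoff v₁ c q p = v₁ := by
  unfold payoff
  rcases h with ⟨h, h'⟩ | ⟨h, h'⟩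
  · rw [winProb_of_lt h, winProb_of_gt h']; ring
  · rw [winProb_of_gt h, winProb_of_lt h']; ring

lemma StrictlyOpposed.ne {q p : Fin 2 → ℝ} (h : StrictlyOpposed q p) (j : Fin 2) :
    q j ≠ p j := by
  fin_cases j <;> rcases h with ⟨h, h'⟩ | ⟨h, h'⟩ <;>
    first | exact h.ne | exact h.ne' | exact h'.ne | exact h'.ne'

/-! ### Utilities as integrals of payoffs -/

section Integrals

variable {v : ℕ → ℝ} {G F : Measure (Fin 2 → ℝ)}

lemma integrable_of_measurable_of_bounds {X : Type*} [MeasurableSpace X] {μ : Measure X}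
    [IsFiniteMeasure μ] {f : X → ℝ} (hf : Measurable f) {C : ℝ} (h0 : ∀ x, 0 ≤ f x)
    (hC : ∀ x, f x ≤ C) : Integrable f μ :=
  Integrable.of_bound hf.aestronglyMeasurable C
    (Filter.Eventually.of_forall fun x => by rw [Real.norm_of_nonneg (h0 x)]; exact hC x)

lemma integrable_winProb [IsFiniteMeasure F] (q : Fin 2 → ℝ) (j : Fin 2) :
    Integrable (fun p : Fin 2 → ℝ => winProb (q j) (p j)) F :=
  integrable_of_measurable_of_bounds (Measurable.winProb (by fun_prop) (by fun_prop))
    (fun _ => winProb_nonneg _ _) (fun _ => winProb_le_one _ _)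

lemma integrable_winProb_mul [IsFiniteMeasure F] (q : Fin 2 → ℝ) :
    Integrable (fun p : Fin 2 → ℝ => winProb (q 0) (p 0) * winProb (q 1) (p 1)) F :=
  integrable_of_measurable_of_bounds ((Measurable.winProb (by fun_prop) (by fun_prop)).mul
      (Measurable.winProb (by fun_prop) (by fun_prop)))
    (fun _ => mul_nonneg (winProb_nonneg _ _) (winProb_nonneg _ _))
    (fun _ => mul_le_one₀ (winProb_le_one _ _) (winProb_nonneg _ _) (winProb_le_one _ _))

lemma integrable_payoff [IsFiniteMeasure F] (v₁ c : ℝ) (q : Fin 2 → ℝ) :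
    Integrable (payoff v₁ c q) F :=
  (((integrable_winProb q 0).add (integrable_winProb q 1)).const_mul _).sub
    ((integrable_winProb_mul q).const_mul _)

lemma integrable_payoff_prod [IsFiniteMeasure G] [IsFiniteMeasure F] {v₁ c : ℝ} (hc0 : 0 ≤ c)
    (hc : c ≤ v₁) :
    Integrable (fun z : (Fin 2 → ℝ) × (Fin 2 → ℝ) => payoff v₁ c z.1 z.2) (G.prod F) :=
  integrable_of_measurable_of_bounds (measurable_payoff v₁ c)
    (fun _ => payoff_nonneg hc0 hc _ _) (fun _ => payoff_le_two_mul hc0 hc _ _)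

lemma integrable_sweepProb_prod [IsFiniteMeasure G] [IsFiniteMeasure F] :
    Integrable (fun z : (Fin 2 → ℝ) × (Fin 2 → ℝ) => sweepProb z.1 z.2) (G.prod F) :=
  integrable_of_measurable_of_bounds measurable_sweepProb
    (fun _ => sweepProb_nonneg _ _) (fun _ => sweepProb_le_two _ _)

lemma univ_finset_fin_two :
    (Finset.univ : Finset (Finset (Fin 2))) = {∅, {0}, {1}, {0, 1}} := by decide

/-- Expanding over the four winning sets, the product terms collect into the coefficient `v 2 - 2 *
v 1`; the empty set drops out by `v 0 = 0`. -/
lemma interimUtility_eq [IsProbabilityMeasure F] (hv0 : v 0 = 0) (q : Fin 2 → ℝ) :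
    interimUtility (anonymousUtility 2 v) q F = ∫ p, payoff (v 1) (2 * v 1 - v 2) q p ∂F := by
  have hx := integrable_winProb (F := F) q 0
  have hy := integrable_winProb (F := F) q 1
  have hxy := integrable_winProb_mul (F := F) q
  have e0 : ({0} : Finset (Fin 2))ᶜ = {1} := by decide
  have e1 : ({1} : Finset (Fin 2))ᶜ = {0} := by decide
  have e2 : ({0, 1} : Finset (Fin 2))ᶜ = ∅ := by decide
  have key : ∀ p : Fin 2 → ℝ, payoff (v 1) (2 * v 1 - v 2) q p =
      winSetProb q p {0} * v 1 + winSetProb q p {1} * v 1 + winSetProb q p {0, 1} * v 2 := by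
    intro p
    simp only [payoff, winSetProb, e0, e1, e2]
    simp
    ring
  have i0 : Integrable (fun p => winSetProb q p {0}) F := by
    simp only [winSetProb, e0, Finset.prod_singleton]
    refine (hx.sub hxy).congr (Filter.Eventually.of_forall fun p => ?_)
    simp only [Pi.sub_apply]; ring
  have i1 : Integrable (fun p => winSetProb q p {1}) F := by
    simp only [winSetProb, e1, Finset.prod_singleton]
    refine (hy.sub hxy).congr (Filter.Eventually.of_forall fun p => ?_)
    simp only [Pi.sub_apply]; ring
  have i2 : Integrable (fun p => winSetProb q p {0, 1}) F := by
    simp only [winSetProb, e2]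
    refine hxy.congr (Filter.Eventually.of_forall fun p => ?_)
    simp
  simp_rw [key]
  have i01 : Integrable (fun p => winSetProb q p {0} * v 1 + winSetProb q p {1} * v 1) F :=
    (i0.mul_const _).add (i1.mul_const _)
  rw [integral_add i01 (i2.mul_const _), integral_add (i0.mul_const _) (i1.mul_const _), integral_mul_const, integral_mul_const,
    integral_mul_const]
  unfold interimUtility
  rw [univ_finset_fin_two, Finset.sum_insert (by decide), Finset.sum_insert (by decide),
    Finset.sum_insert (by decide), Finset.sum_singleton]
  simp [anonymousUtility, winSetProbAgainst, hv0]
  ring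

lemma expectedUtility_eq [IsProbabilityMeasure F] (hv0 : v 0 = 0) :
    expectedUtility (anonymousUtility 2 v) G F =
      ∫ q, ∫ p, payoff (v 1) (2 * v 1 - v 2) q p ∂F ∂G := by
  simp only [expectedUtility, interimUtility_eq hv0]

lemma expectedUtility_eq_prod [IsProbabilityMeasure F] [IsProbabilityMeasure G] (hv0 : v 0 = 0)
    (hc0 : v 2 ≤ 2 * v 1) (hc : v 1 ≤ v 2) :
    expectedUtility (anonymousUtility 2 v) G F =
      ∫ z, payoff (v 1) (2 * v 1 - v 2) z.1 z.2 ∂(G.prod F) := by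
  rw [expectedUtility_eq hv0, integral_prod]
  exact integrable_payoff_prod (by linarith) (by linarith)

lemma measurable_integral_payoff [SFinite F] (v₁ c : ℝ) :
    Measurable (fun q => ∫ p, payoff v₁ c q p ∂F) :=
  ((measurable_payoff v₁ c).stronglyMeasurable.integral_prod_right (ν := F)).measurable

lemma welfare_self_eq [IsProbabilityMeasure G] (hv0 : v 0 = 0) (hc0 : v 2 ≤ 2 * v 1)
    (hc : v 1 ≤ v 2) :
    welfare (anonymousUtility 2 v) G G =
      2 * v 1 - (2 * v 1 - v 2) * ∫ z, sweepProb z.1 z.2 ∂(G.prod G) := by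
  have hi := integrable_payoff_prod (G := G) (F := G) (v₁ := v 1) (c := 2 * v 1 - v 2)
    (by linarith) (by linarith)
  have hswap := integral_prod_swap (μ := G) (ν := G)
    (fun z : (Fin 2 → ℝ) × (Fin 2 → ℝ) => payoff (v 1) (2 * v 1 - v 2) z.1 z.2)
  have e : welfare (anonymousUtility 2 v) G G =
      ∫ z, (payoff (v 1) (2 * v 1 - v 2) z.1 z.2 + payoff (v 1) (2 * v 1 - v 2) z.2 z.1)
        ∂(G.prod G) := by
    have hi' : Integrable (fun z : (Fin 2 → ℝ) × (Fin 2 → ℝ) =>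
        payoff (v 1) (2 * v 1 - v 2) z.2 z.1) (G.prod G) := hi.swap
    rw [integral_add hi hi', welfare, expectedUtility_eq_prod hv0 hc0 hc]
    congr 1
    exact hswap.symm
  rw [e]
  simp_rw [payoff_add_payoff_swap]
  rw [integral_sub (integrable_const _) (integrable_sweepProb_prod.const_mul _),
    integral_const_mul (2 * v 1 - v 2)
      (fun z : (Fin 2 → ℝ) × (Fin 2 → ℝ) => sweepProb z.1 z.2)]
  simp

lemma optimalWelfare_eq (hv0 : v 0 = 0) (hc0 : v 2 ≤ 2 * v 1) :
    optimalWelfare (anonymousUtility 2 v) = 2 * v 1 := by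
  unfold optimalWelfare
  apply le_antisymm
  · refine Finset.sup'_le _ _ fun S _ => ?_
    have hS : S ∈ ({∅, {0}, {1}, {0, 1}} : Finset (Finset (Fin 2))) := by
      rw [← univ_finset_fin_two]; exact Finset.mem_univ S
    have e0 : ({0} : Finset (Fin 2))ᶜ = {1} := by decide
    have e1 : ({1} : Finset (Fin 2))ᶜ = {0} := by decide
    have e2 : ({0, 1} : Finset (Fin 2))ᶜ = ∅ := by decide
    simp only [Finset.mem_insert, Finset.mem_singleton] at hS
    rcases hS with rfl | rfl | rfl | rfl
    · simpa [anonymousUtility, hv0] using hc0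
    · simp [anonymousUtility, e0]; linarith
    · simp [anonymousUtility, e1]; linarith
    · simp [anonymousUtility, e2, hv0]; linarith
  · refine le_trans ?_ (Finset.le_sup' _ (Finset.mem_univ ({0} : Finset (Fin 2))))
    have e0 : ({0} : Finset (Fin 2))ᶜ = {1} := by decide
    simp [anonymousUtility, e0]; linarith

lemma welfare_self_le [IsProbabilityMeasure G] (hv0 : v 0 = 0) (hc0 : v 2 ≤ 2 * v 1)
    (hc : v 1 ≤ v 2) : welfare (anonymousUtility 2 v) G G ≤ 2 * v 1 := by
  rw [welfare_self_eq hv0 hc0 hc]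
  have := integral_nonneg (μ := G.prod G)
    (f := fun z : (Fin 2 → ℝ) × (Fin 2 → ℝ) => sweepProb z.1 z.2)
    (fun z => sweepProb_nonneg z.1 z.2)
  nlinarith

lemma welfare_self_eq_iff [IsProbabilityMeasure G] (hv0 : v 0 = 0) (hc0 : v 2 < 2 * v 1)
    (hc : v 1 ≤ v 2) : welfare (anonymousUtility 2 v) G G = 2 * v 1 ↔
      ∀ᵐ q ∂G, ∀ᵐ p ∂G, StrictlyOpposed q p := by
  have h0 : 0 < 2 * v 1 - v 2 := by linarith
  have hm : MeasurableSet {z : (Fin 2 → ℝ) × (Fin 2 → ℝ) | StrictlyOpposed z.1 z.2} := by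
    simp_rw [← sweepProb_eq_zero_iff]
    exact measurable_sweepProb (measurableSet_singleton 0)
  rw [← Measure.ae_prod_iff_ae_ae hm, welfare_self_eq hv0 hc0.le hc, sub_eq_self,
    mul_eq_zero, or_iff_right h0.ne',
    integral_eq_zero_iff_of_nonneg
      (f := fun z : (Fin 2 → ℝ) × (Fin 2 → ℝ) => sweepProb z.1 z.2) (fun z => sweepProb_nonneg z.1 z.2) integrable_sweepProb_prod]
  simp only [Filter.EventuallyEq, Pi.zero_apply, sweepProb_eq_zero_iff]

lemma welfare_self_eq_two_mul :
    welfare (anonymousUtility 2 v) G G = 2 * expectedUtility (anonymousUtility 2 v) G G := by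
  rw [welfare]; ring

end Integrals

lemma IsSignalingPolicy.integrable {n : ℕ} {lam : ℝ} {G : Measure (Fin n → ℝ)}
    (hG : IsSignalingPolicy lam G) (j : Fin n) : Integrable (fun q => q j) G := by
  have := hG.isProbabilityMeasure
  refine Integrable.of_bound (measurable_pi_apply j).aestronglyMeasurable 1 ?_
  filter_upwards [hG.mem_cube] with q hq
  rw [Real.norm_of_nonneg (hq j).1]; exact (hq j).2

/-- No Bayes-plausible policy with prior above `1 / 2` lives on a segment between the axes. -/
lemma IsSignalingPolicy.not_support_subset_segment {lam : ℝ} (hlam : 1 / 2 < lam)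
    {G : Measure (Fin 2 → ℝ)} (hG : IsSignalingPolicy lam G) {a b : ℝ}
    (ha : a ∈ Set.Ioc (0 : ℝ) 1) (hb : b ∈ Set.Ioc (0 : ℝ) 1) :
    ¬ G.support ⊆ segment ℝ ![0, b] ![a, 0] := by
  intro h
  have := hG.isProbabilityMeasure
  -- Integrating the equation of the line gives `(a + b) * lam = a * b`, impossible for `a, b ≤ 1`
  -- and `lam > 1 / 2`.
  have hae : ∀ᵐ q ∂G, b * q 0 + a * q 1 = a * b := by
    filter_upwards [Measure.support_mem_ae (μ := G)] with q hq
    obtain ⟨s, t, hs, ht, hst, rfl⟩ := h hq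
    simp
    linear_combination (a * b) * hst
  have h1 : ∫ q, (b * q 0 + a * q 1) ∂G = a * b := by
    rw [integral_congr_ae hae]; simp
  rw [integral_add ((hG.integrable 0).const_mul _) ((hG.integrable 1).const_mul _),
    integral_const_mul, integral_const_mul, hG.bayesPlausible, hG.bayesPlausible] at h1
  have ha' := ha.1
  have hb' := hb.1
  nlinarith [ha.2, hb.2, mul_pos ha' hb']

/-! ### Deviations: point masses and mixtures -/

section Deviations

variable {v : ℕ → ℝ} {lam : ℝ} {G F : Measure (Fin 2 → ℝ)}

/-- The mixture of `μ` and `ν` with weights `s` and `t`. -/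
noncomputable def mixture (s t : ℝ) (μ ν : Measure (Fin 2 → ℝ)) : Measure (Fin 2 → ℝ) :=
  ENNReal.ofReal s • μ + ENNReal.ofReal t • ν

lemma integral_mixture {s t : ℝ} (hs : 0 ≤ s) (ht : 0 ≤ t) {μ ν : Measure (Fin 2 → ℝ)}
    {f : (Fin 2 → ℝ) → ℝ} (hμ : Integrable f μ) (hν : Integrable f ν) :
    ∫ q, f q ∂(mixture s t μ ν) = s * ∫ q, f q ∂μ + t * ∫ q, f q ∂ν := by
  rw [mixture, integral_add_measure (hμ.smul_measure ENNReal.ofReal_ne_top)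
    (hν.smul_measure ENNReal.ofReal_ne_top), integral_smul_measure, integral_smul_measure,
    ENNReal.toReal_ofReal hs, ENNReal.toReal_ofReal ht]
  simp

lemma isProbabilityMeasure_mixture {s t : ℝ} (hs : 0 ≤ s) (ht : 0 ≤ t) (hst : s + t = 1)
    (μ ν : Measure (Fin 2 → ℝ)) [IsProbabilityMeasure μ] [IsProbabilityMeasure ν] :
    IsProbabilityMeasure (mixture s t μ ν) := by
  constructor
  simp [mixture, ← ENNReal.ofReal_add hs ht, hst]

lemma ae_mixture {s t : ℝ} {μ ν : Measure (Fin 2 → ℝ)} {P : (Fin 2 → ℝ) → Prop}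
    (hμ : ∀ᵐ q ∂μ, P q) (hν : ∀ᵐ q ∂ν, P q) : ∀ᵐ q ∂(mixture s t μ ν), P q := by
  rw [mixture, ae_add_measure_iff]
  exact ⟨Measure.ae_smul_measure hμ _, Measure.ae_smul_measure hν _⟩

/-- `μ` is a distribution on the unit square with mean `x` and `∫ W ∂μ ≥ t`. -/
structure Attains (W : (Fin 2 → ℝ) → ℝ) (x : Fin 2 → ℝ) (t : ℝ)
    (μ : Measure (Fin 2 → ℝ)) : Prop where
  isProbabilityMeasure : IsProbabilityMeasure μ
  mem_cube : ∀ᵐ q ∂μ, ∀ j, q j ∈ Set.Icc (0 : ℝ) 1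
  mean : ∀ j, ∫ q, q j ∂μ = x j
  le_integral : t ≤ ∫ q, W q ∂μ

lemma Attains.integrable {W : (Fin 2 → ℝ) → ℝ} {x : Fin 2 → ℝ} {t : ℝ}
    {μ : Measure (Fin 2 → ℝ)} (h : Attains W x t μ) (j : Fin 2) :
    Integrable (fun q => q j) μ := by
  have := h.isProbabilityMeasure
  refine Integrable.of_bound (measurable_pi_apply j).aestronglyMeasurable 1 ?_
  filter_upwards [h.mem_cube] with q hq
  rw [Real.norm_of_nonneg (hq j).1]; exact (hq j).2

lemma attains_dirac {W : (Fin 2 → ℝ) → ℝ} (hW : Measurable W) {x : Fin 2 → ℝ}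
    (hx : ∀ j, x j ∈ Set.Icc (0 : ℝ) 1) {t : ℝ} (ht : t ≤ W x) :
    Attains W x t (Measure.dirac x) where
  isProbabilityMeasure := inferInstance
  mem_cube := by
    rw [ae_dirac_iff]
    · exact hx
    · simp_rw [Set.ofPred_forall]
      exact MeasurableSet.iInter fun j => measurable_pi_apply j measurableSet_Icc
  mean j := integral_dirac' _ _ (measurable_pi_apply j).stronglyMeasurable
  le_integral := by rwa [integral_dirac' _ _ hW.stronglyMeasurable]

lemma Attains.mixture {W : (Fin 2 → ℝ) → ℝ} (hW : Measurable W) {C : ℝ} (h0 : ∀ q, 0 ≤ W q)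
    (hC : ∀ q, W q ≤ C) {x y : Fin 2 → ℝ} {t u : ℝ} {μ ν : Measure (Fin 2 → ℝ)}
    (hμ : Attains W x t μ) (hν : Attains W y u ν) {a b : ℝ} (ha : 0 ≤ a) (hb : 0 ≤ b)
    (hab : a + b = 1) :
    Attains W (a • x + b • y) (a * t + b * u) (mixture a b μ ν) where
  isProbabilityMeasure := by
    have := hμ.isProbabilityMeasure
    have := hν.isProbabilityMeasure
    exact isProbabilityMeasure_mixture ha hb hab μ ν
  mem_cube := ae_mixture hμ.mem_cube hν.mem_cube
  mean j := by
    rw [integral_mixture ha hb (hμ.integrable j) (hν.integrable j), hμ.mean, hν.mean]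
    simp
  le_integral := by
    have := hμ.isProbabilityMeasure
    have := hν.isProbabilityMeasure
    rw [integral_mixture ha hb (integrable_of_measurable_of_bounds hW h0 hC)
      (integrable_of_measurable_of_bounds hW h0 hC)]
    exact add_le_add (mul_le_mul_of_nonneg_left hμ.le_integral ha)
      (mul_le_mul_of_nonneg_left hν.le_integral hb)

lemma Attains.isSignalingPolicy {W : (Fin 2 → ℝ) → ℝ} {x : Fin 2 → ℝ} {t : ℝ}
    {μ : Measure (Fin 2 → ℝ)} (h : Attains W x t μ) (hx : ∀ j, x j = lam) :
    IsSignalingPolicy lam μ :=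
  ⟨h.isProbabilityMeasure, h.mem_cube, fun j => (h.mean j).trans (hx j)⟩

/-- A function whose expectation over all distributions on the unit square with mean `(lam, lam)`
is at most `M` lies below an affine function with value `M` at `(lam, lam)`. -/
lemma exists_affine_majorant (h0 : 0 < lam) (h1 : lam < 1) {W : (Fin 2 → ℝ) → ℝ}
    (hW : Measurable W) {C : ℝ} (hW0 : ∀ q, 0 ≤ W q) (hC : ∀ q, W q ≤ C) {M : ℝ}
    (hM : ∀ μ, IsSignalingPolicy lam μ → ∫ q, W q ∂μ ≤ M) :
    ∃ α β₀ β₁ : ℝ, (∀ q : Fin 2 → ℝ, (∀ j, q j ∈ Set.Icc (0 : ℝ) 1) →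
      W q ≤ α + β₀ * q 0 + β₁ * q 1) ∧ α + β₀ * lam + β₁ * lam = M := by
  -- `K` is the region below the concave envelope of `W`. It is convex by mixing, contains the
  -- hypograph of `W` by point masses, and over the prior has no point higher than `M`.
  set K : Set ((Fin 2 → ℝ) × ℝ) := {z | ∃ μ, Attains W z.1 z.2 μ} with hK
  set m : (Fin 2 → ℝ) × ℝ := (fun _ => lam, M) with hm
  have hconv : Convex ℝ K := by
    rintro z ⟨μ, hμ⟩ w ⟨ν, hν⟩ a b ha hb hab
    exact ⟨_, hμ.mixture hW hW0 hC hν ha hb hab⟩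
  have hmem : ∀ q : Fin 2 → ℝ, (∀ j, q j ∈ Set.Icc (0 : ℝ) 1) → ∀ t ≤ W q, (q, t) ∈ K :=
    fun q hq t ht => ⟨_, attains_dirac hW hq ht⟩
  -- Since `W ≥ 0`, the open square times the negative heights lies in `K`; this gives an interior
  -- point over the prior.
  have hint : ((fun _ => lam, -1) : (Fin 2 → ℝ) × ℝ) ∈ interior K := by
    rw [mem_interior]
    refine ⟨(Set.univ.pi fun _ => Set.Ioo (0 : ℝ) 1) ×ˢ Set.Iio 0, ?_,
      (isOpen_set_pi Set.finite_univ fun _ _ => isOpen_Ioo).prod isOpen_Iio, ?_⟩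
    · rintro ⟨q, t⟩ ⟨hq, ht⟩
      exact hmem q (fun j => Set.Ioo_subset_Icc_self (hq j trivial)) t
        ((Set.mem_Iio.1 ht).le.trans (hW0 q))
    · exact ⟨fun _ _ => ⟨h0, h1⟩, by simp⟩
  have hm_not : m ∉ interior K := by
    intro hmi
    have hcont : Filter.Tendsto (fun t : ℝ => ((fun _ => lam, t) : (Fin 2 → ℝ) × ℝ)) (nhds M)
        (nhds m) := by
      have : Continuous (fun t : ℝ => ((fun _ => lam, t) : (Fin 2 → ℝ) × ℝ)) := by fun_prop
      exact this.tendsto M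
    have hev := hcont.eventually (mem_interior_iff_mem_nhds.1 hmi)
    obtain ⟨t, ⟨μ, hμ⟩, ht⟩ :=
      ((hev.filter_mono nhdsWithin_le_nhds).and (self_mem_nhdsWithin (s := Set.Ioi M))).exists
    have := hM μ (hμ.isSignalingPolicy fun _ => rfl)
    exact absurd (hμ.le_integral.trans this) (not_le.2 ht)
  obtain ⟨f, hf⟩ := geometric_hahn_banach_open_point hconv.interior isOpen_interior hm_not
  have hle : ∀ z ∈ K, f z ≤ f m := by
    intro z hz
    have hz' : z ∈ closure (interior K) := by
      rw [hconv.closure_interior_eq_closure_of_nonempty_interior ⟨_, hint⟩]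
      exact subset_closure hz
    have hcl : IsClosed {z | f z ≤ f m} := isClosed_le f.continuous continuous_const
    exact closure_minimal (fun w hw => (hf w hw).le) hcl hz'
  set f₀ := f (![1, 0], 0) with hf₀
  set f₁ := f (![0, 1], 0) with hf₁
  set s := f (0, 1) with hs
  have hf_eq : ∀ (q : Fin 2 → ℝ) (t : ℝ), f (q, t) = q 0 * f₀ + q 1 * f₁ + t * s := by
    intro q t
    have : ((q, t) : (Fin 2 → ℝ) × ℝ) =
        q 0 • (![1, 0], 0) + q 1 • (![0, 1], 0) + t • ((0 : Fin 2 → ℝ), (1 : ℝ)) := by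
      ext j
      · fin_cases j <;> simp
      · simp
    conv_lhs => rw [this]
    simp only [map_add, map_smul, smul_eq_mul]
    rfl
  have hle' : ∀ q : Fin 2 → ℝ, (∀ j, q j ∈ Set.Icc (0 : ℝ) 1) → ∀ t ≤ W q,
      q 0 * f₀ + q 1 * f₁ + t * s ≤ lam * f₀ + lam * f₁ + M * s := by
    intro q hq t ht
    have := hle _ (hmem q hq t ht)
    rwa [hm, hf_eq, hf_eq] at this
  have hstrict : lam * f₀ + lam * f₁ + -1 * s < lam * f₀ + lam * f₁ + M * s := by
    have := hf _ hint
    rwa [hm, hf_eq, hf_eq] at this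
  have hlamIcc : ∀ j : Fin 2, (fun _ => lam : Fin 2 → ℝ) j ∈ Set.Icc (0 : ℝ) 1 :=
    fun _ => ⟨h0.le, h1.le⟩
  have hM0 : 0 ≤ M := by
    have hd := attains_dirac hW hlamIcc (hW0 fun _ => lam)
    exact hd.le_integral.trans (hM _ (hd.isSignalingPolicy fun _ => rfl))
  -- The supporting hyperplane is not vertical: it separates strictly two points over the same base,
  -- at heights `-1` and `M ≥ 0`.
  have hspos : 0 < s := by
    by_contra hcon
    nlinarith
  refine ⟨M + lam * (f₀ + f₁) / s, -f₀ / s, -f₁ / s, fun q hq => ?_, ?_⟩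
  · have := hle' q hq (W q) le_rfl
    have e : M + lam * (f₀ + f₁) / s + -f₀ / s * q 0 + -f₁ / s * q 1 =
        (M * s + lam * f₀ + lam * f₁ - q 0 * f₀ - q 1 * f₁) / s := by
      field_simp; ring
    rw [e, le_div_iff₀ hspos]
    linarith
  · field_simp; ring

end Deviations

section Welfare

variable {v : ℕ → ℝ} {lam : ℝ} {G F : Measure (Fin 2 → ℝ)}

/-! ### Welfare loss for priors above one half -/

lemma le_winProb_one {t : ℝ} (ht : t ≤ 1) : 1 - ({1} : Set ℝ).indicator 1 t / 2 ≤ winProb 1 t := by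
  rcases ht.lt_or_eq with h | rfl
  · rw [winProb_of_lt h]; simp [h.ne]
  · rw [winProb_self]; norm_num

lemma IsSignalingPolicy.integrable_tie_one (hG : IsSignalingPolicy lam G) (j : Fin 2) :
    Integrable (fun p : Fin 2 → ℝ => ({1} : Set ℝ).indicator (1 : ℝ → ℝ) (p j)) G := by
  have := hG.isProbabilityMeasure
  refine integrable_of_measurable_of_bounds (C := 1)
    ((measurable_one.indicator (measurableSet_singleton 1)).comp (measurable_pi_apply j))
    (fun p => Set.indicator_nonneg (fun _ _ => zero_le_one) _)
    (fun p => Set.indicator_le_self' (fun _ _ => zero_le_one) _)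

lemma integral_tie_one (j : Fin 2) :
    ∫ p : Fin 2 → ℝ, ({1} : Set ℝ).indicator (1 : ℝ → ℝ) (p j) ∂G =
      G.real {p | p j = 1} := by
  have hm : MeasurableSet {p : Fin 2 → ℝ | p j = 1} :=
    measurable_pi_apply j (measurableSet_singleton 1)
  rw [← integral_indicator_one hm]
  rfl

/-- Signal `1` loses receiver `j` only in a tie at `1`; the other receiver can only add to the
payoff because `c ≤ v₁`. -/
lemma IsSignalingPolicy.le_integral_payoff_single (hG : IsSignalingPolicy lam G) {v₁ c : ℝ}
    (hc0 : 0 ≤ c) (hc : c ≤ v₁) {q : Fin 2 → ℝ} (j : Fin 2) (hq : q j = 1) :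
    v₁ * (1 - G.real {p | p j = 1} / 2) ≤ ∫ p, payoff v₁ c q p ∂G := by
  have := hG.isProbabilityMeasure
  have hi := hG.integrable_tie_one j
  have e : v₁ * (1 - G.real {p | p j = 1} / 2) =
      ∫ p : Fin 2 → ℝ, v₁ * (1 - ({1} : Set ℝ).indicator (1 : ℝ → ℝ) (p j) / 2) ∂G := by
    rw [integral_const_mul, integral_sub (integrable_const _) (hi.div_const _),
      integral_div, integral_tie_one]
    simp
  rw [e]
  refine integral_mono_ae (((integrable_const _).sub (hi.div_const _)).const_mul _)
    (integrable_payoff v₁ c q) ?_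
  filter_upwards [hG.mem_cube] with p hp
  refine (mul_le_mul_of_nonneg_left (le_winProb_one (hp j).2) (hc0.trans hc)).trans ?_
  rw [← hq]
  have h0 := winProb_nonneg (q 0) (p 0)
  have h0' := winProb_le_one (q 0) (p 0)
  have h1 := winProb_nonneg (q 1) (p 1)
  have h1' := winProb_le_one (q 1) (p 1)
  unfold payoff
  fin_cases j
  · simp only [Fin.zero_eta]
    nlinarith [mul_nonneg hc0 (mul_nonneg h1 (sub_nonneg.2 h0')), mul_nonneg (sub_nonneg.2 hc) h1]
  · simp only [Fin.mk_one]
    nlinarith [mul_nonneg hc0 (mul_nonneg h0 (sub_nonneg.2 h1')), mul_nonneg (sub_nonneg.2 hc) h0]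

lemma IsSignalingPolicy.le_integral_payoff_one (hG : IsSignalingPolicy lam G) {v₁ c : ℝ}
    (hc0 : 0 ≤ c) (hc : c ≤ v₁) :
    2 * v₁ - c - v₁ * (G.real {p | p 0 = 1} + G.real {p | p 1 = 1}) / 2 ≤
      ∫ p, payoff v₁ c ![1, 1] p ∂G := by
  have := hG.isProbabilityMeasure
  have hi : Integrable (fun p : Fin 2 → ℝ => v₁ / 2 * (({1} : Set ℝ).indicator (1 : ℝ → ℝ) (p 0) +
      ({1} : Set ℝ).indicator (1 : ℝ → ℝ) (p 1))) G :=
    ((hG.integrable_tie_one 0).add (hG.integrable_tie_one 1)).const_mul (v₁ / 2)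
  have e : 2 * v₁ - c - v₁ * (G.real {p | p 0 = 1} + G.real {p | p 1 = 1}) / 2 =
      ∫ p : Fin 2 → ℝ, ((2 * v₁ - c) - v₁ / 2 * (({1} : Set ℝ).indicator (1 : ℝ → ℝ) (p 0) +
        ({1} : Set ℝ).indicator (1 : ℝ → ℝ) (p 1))) ∂G := by
    rw [integral_sub (integrable_const _) hi, integral_const_mul,
      integral_add (hG.integrable_tie_one 0) (hG.integrable_tie_one 1), integral_tie_one,
      integral_tie_one]
    simp
    ring
  rw [e]
  refine integral_mono_ae ((integrable_const _).sub hi) (integrable_payoff v₁ c _) ?_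
  filter_upwards [hG.mem_cube] with p hp
  have a0 := le_winProb_one (hp 0).2
  have a1 := le_winProb_one (hp 1).2
  have h0' := winProb_le_one 1 (p 0)
  have h1' := winProb_le_one 1 (p 1)
  have b0 := winProb_nonneg 1 (p 0)
  simp only [payoff, Matrix.cons_val_zero, Matrix.cons_val_one]
  have hv := hc0.trans hc
  nlinarith [mul_le_mul_of_nonneg_left a0 hv, mul_le_mul_of_nonneg_left a1 hv,
    mul_nonneg hc0 (sub_nonneg.2 (mul_le_one₀ h0' (winProb_nonneg 1 (p 1)) h1'))]

lemma IsSignalingPolicy.sq_le_integral_sweepProb (hG : IsSignalingPolicy lam G) (j : Fin 2) :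
    G.real {p | p j = 1} ^ 2 / 2 ≤ ∫ z, sweepProb z.1 z.2 ∂(G.prod G) := by
  have := hG.isProbabilityMeasure
  set A : Set (Fin 2 → ℝ) := {p | p j = 1} with hA
  have hAm : MeasurableSet A := measurable_pi_apply j (measurableSet_singleton 1)
  have e : G.real A ^ 2 / 2 = ∫ z, (A ×ˢ A).indicator (fun _ => (1 / 2 : ℝ)) z ∂(G.prod G) := by
    rw [integral_indicator_const _ (hAm.prod hAm), measureReal_prod_prod, smul_eq_mul]
    ring
  rw [e]
  refine integral_mono ((integrable_const _).indicator (hAm.prod hAm))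
    integrable_sweepProb_prod fun z => ?_
  refine Set.indicator_le' (fun z hz => ?_) (fun z _ => sweepProb_nonneg _ _) z
  exact (sweepProb_of_tie (j := j) (hz.1.trans hz.2.symm)).ge

/-- For a prior above `1 / 2` the welfare of symmetric equilibria is bounded away from `2 * v 1`. -/
lemma exists_welfare_gap (hv0 : v 0 = 0) (h01 : 0 < v 1) (h12 : v 1 < v 2) (hc : v 2 < 2 * v 1)
    (hlam : 1 / 2 < lam) (hlam1 : lam < 1) :
    ∃ δ > 0, ∀ G : Measure (Fin 2 → ℝ), IsEquilibrium (anonymousUtility 2 v) lam G G →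
      welfare (anonymousUtility 2 v) G G ≤ 2 * v 1 - δ := by
  -- Half of the lower bound on the total mass of ties at `1` that makes the three-point deviation
  -- unprofitable.
  set κ : ℝ := (2 * lam - 1) * (v 2 - v 1) / v 1 with hκ
  have hκ0 : 0 < κ := div_pos (mul_pos (by linarith) (by linarith)) h01
  refine ⟨(2 * v 1 - v 2) * (κ ^ 2 / 2), mul_pos (by linarith) (by positivity), ?_⟩
  intro G hG
  obtain ⟨⟨hGp, hbest⟩, -⟩ := hG
  have := hGp.isProbabilityMeasure
  set c := 2 * v 1 - v 2 with hcdef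
  have hc0 : 0 ≤ c := by linarith
  have hcv : c ≤ v 1 := by linarith
  set W : (Fin 2 → ℝ) → ℝ := fun q => ∫ p, payoff (v 1) c q p ∂G with hWdef
  have hWm : Measurable W := measurable_integral_payoff _ _
  have hW0 : ∀ q, 0 ≤ W q := fun q => integral_nonneg fun p => payoff_nonneg hc0 hcv q p
  have hWC : ∀ q, W q ≤ 2 * v 1 := fun q => by
    have := integral_mono (integrable_payoff (F := G) (v 1) c q) (integrable_const (2 * v 1))
      fun p => payoff_le_two_mul hc0 hcv q p
    simpa using this
  have hU : expectedUtility (anonymousUtility 2 v) G G ≤ v 1 := by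
    have := welfare_self_le (G := G) hv0 hc.le h12.le
    rw [welfare_self_eq_two_mul] at this
    linarith
  have d1 : Attains W ![0, 1] _ _ := attains_dirac hWm
    (fun j => by fin_cases j <;> simp) (hGp.le_integral_payoff_single hc0 hcv 1 (by simp))
  have d2 : Attains W ![1, 0] _ _ := attains_dirac hWm
    (fun j => by fin_cases j <;> simp) (hGp.le_integral_payoff_single hc0 hcv 0 (by simp))
  have d3 : Attains W ![1, 1] _ _ := attains_dirac hWm
    (fun j => by fin_cases j <;> simp) (hGp.le_integral_payoff_one hc0 hcv)
  -- Each coordinate has mean `(1 - lam) + (2 * lam - 1) = lam`.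
  have d := (d1.mixture hWm hW0 hWC d2 (a := 1 / 2) (b := 1 / 2) (by norm_num) (by norm_num)
    (by norm_num)).mixture hWm hW0 hWC d3 (a := 2 * (1 - lam)) (b := 2 * lam - 1) (by linarith)
    (by linarith) (by ring)
  have hd := hbest _ (d.isSignalingPolicy (lam := lam) fun j => by
    fin_cases j <;> simp <;> ring)
  rw [expectedUtility_eq hv0] at hd
  have key := (d.le_integral.trans hd).trans hU
  set m₀ := G.real {p | p 0 = 1} with hm₀
  set m₁ := G.real {p | p 1 = 1} with hm₁
  have p0 : 0 ≤ m₀ := measureReal_nonneg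
  have p1 : 0 ≤ m₁ := measureReal_nonneg
  -- Ties at `1` cost the deviation at most `lam * v 1 * (m₀ + m₁) / 2`, which has to cover its gain
  -- `(2 * lam - 1) * (v 2 - v 1)`.
  have hsum : 2 * κ ≤ m₀ + m₁ := by
    rw [hκ, ← mul_div_assoc, div_le_iff₀ h01]
    have : lam * (v 1 * (m₀ + m₁)) ≤ 1 * (v 1 * (m₀ + m₁)) :=
      mul_le_mul_of_nonneg_right hlam1.le (by positivity)
    rw [hcdef] at key
    nlinarith
  have hj : ∃ j : Fin 2, κ ≤ G.real {p | p j = 1} := by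
    by_contra! hcon
    have := hcon 0
    have := hcon 1
    linarith
  obtain ⟨j, hj⟩ := hj
  rw [welfare_self_eq hv0 hc.le h12.le]
  have h1 := hGp.sq_le_integral_sweepProb j
  have h2 : κ ^ 2 ≤ G.real {p | p j = 1} ^ 2 := pow_le_pow_left₀ hκ0.le hj 2
  have := mul_le_mul_of_nonneg_left (h1.trans' (div_le_div_of_nonneg_right h2 zero_le_two)) hc0
  linarith

/-! ### Supports of welfare-optimal equilibria -/

/-- If `p j = t` had positive mass, some signal with `j`-th coordinate `t` would be opposed to
almost every signal, hence tie with almost none. So the marginals have no atoms. -/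
lemma ae_coord_ne (hopp : ∀ᵐ q ∂G, ∀ᵐ p ∂G, StrictlyOpposed q p) (j : Fin 2) (t : ℝ) :
    ∀ᵐ p ∂G, p j ≠ t := by
  by_contra hcon
  obtain ⟨q, hq, hqo⟩ := (Filter.Frequently.and_eventually
    (Filter.not_eventually.1 hcon) hopp).exists
  refine hcon (hqo.mono fun p hp => ?_)
  have := hp.ne j
  rw [not_not.1 hq] at this
  exact this.symm

lemma integral_payoff_of_opposed [IsProbabilityMeasure G] {q : Fin 2 → ℝ}
    (h : ∀ᵐ p ∂G, StrictlyOpposed q p) (v₁ c : ℝ) : ∫ p, payoff v₁ c q p ∂G = v₁ := by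
  rw [integral_congr_ae (h.mono fun p hp => hp.payoff_eq v₁ c)]
  simp

/-- If the policy `G` is carried by a decreasing line, any two of its signals are opposed, and
every point of the unit square opposed to almost every signal lies above the line, then the
support of `G` is the part of the line in the unit square, and that is a segment between the
axes. -/
lemma IsSignalingPolicy.support_eq_segment (hG : IsSignalingPolicy lam G)
    (hopp : ∀ᵐ q ∂G, ∀ᵐ p ∂G, StrictlyOpposed q p) {β₀ β₁ d : ℝ} (hβ₀ : 0 < β₀) (hβ₁ : 0 < β₁)
    (hd : 0 < d) (hline : ∀ᵐ p ∂G, β₀ * p 0 + β₁ * p 1 = d)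
    (habove : ∀ q : Fin 2 → ℝ, (∀ j, q j ∈ Set.Icc (0 : ℝ) 1) →
      (∀ᵐ p ∂G, StrictlyOpposed q p) → d ≤ β₀ * q 0 + β₁ * q 1) :
    ∃ a ∈ Set.Ioc (0 : ℝ) 1, ∃ b ∈ Set.Ioc (0 : ℝ) 1,
      G.support = segment ℝ ![0, b] ![a, 0] := by
  have hne := ae_coord_ne hopp
  -- Without atoms in the marginals, the corners `(0,1)` and `(1,0)` are opposed to almost every
  -- signal, so they lie above the line; this bounds the intercepts by `1`.
  have hβ₁d : d ≤ β₁ := by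
    have := habove ![0, 1] (fun j => by fin_cases j <;> simp) (by
      filter_upwards [hne 0 0, hne 1 1, hG.mem_cube] with p h0 h1 hp
      exact Or.inr ⟨by simpa using (hp 0).1.lt_of_ne' h0, by simpa using (hp 1).2.lt_of_ne h1⟩)
    simpa using this
  have hβ₀d : d ≤ β₀ := by
    have := habove ![1, 0] (fun j => by fin_cases j <;> simp) (by
      filter_upwards [hne 0 1, hne 1 0, hG.mem_cube] with p h0 h1 hp
      exact Or.inl ⟨by simpa using (hp 0).2.lt_of_ne h0, by simpa using (hp 1).1.lt_of_ne' h1⟩)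
    simpa using this
  have ha : d / β₀ ∈ Set.Ioc (0 : ℝ) 1 := ⟨by positivity, (div_le_one hβ₀).2 hβ₀d⟩
  have hb : d / β₁ ∈ Set.Ioc (0 : ℝ) 1 := ⟨by positivity, (div_le_one hβ₁).2 hβ₁d⟩
  set a := d / β₀ with ha_def
  set b := d / β₁ with hb_def
  have haβ : β₀ * a = d := by rw [ha_def]; field_simp
  have hbβ : β₁ * b = d := by rw [hb_def]; field_simp
  refine ⟨a, ha, b, hb, Set.Subset.antisymm ?_ ?_⟩
  · set L : Set (Fin 2 → ℝ) := {p | β₀ * p 0 + β₁ * p 1 = d} ∩ {p | 0 ≤ p 0} ∩ {p | 0 ≤ p 1}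
      with hL
    have hLc : IsClosed L :=
      ((isClosed_eq (by fun_prop) (by fun_prop)).inter
        (isClosed_le (by fun_prop) (by fun_prop))).inter (isClosed_le (by fun_prop) (by fun_prop))
    have hsub : G.support ⊆ L := by
      refine Measure.support_subset_of_isClosed hLc ?_
      filter_upwards [hline, hG.mem_cube] with p h hp
      exact ⟨⟨h, (hp 0).1⟩, (hp 1).1⟩
    intro p hp
    obtain ⟨⟨hp, h0⟩, h1⟩ := hsub hp
    simp only [Set.mem_ofPred_eq] at hp h0 h1
    refine ⟨p 1 / b, p 0 / a, div_nonneg h1 hb.1.le, div_nonneg h0 ha.1.le, ?_, ?_⟩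
    · rw [ha_def, hb_def]; field_simp; linarith
    · have := ha.1.ne'
      have := hb.1.ne'
      ext j; fin_cases j
      · simp; field_simp
      · simp; field_simp
  · set z : ℝ → Fin 2 → ℝ := fun t => ![t * a, (1 - t) * b] with hz
    have hzc : Continuous z := by
      rw [hz]
      refine continuous_pi fun j => ?_
      fin_cases j <;> simp <;> fun_prop
    -- The contradiction comes from shifting `z t` to the left, which needs `t * a > 0`; the
    -- endpoint `t = 0` follows by closure.
    have hIoc : Set.Ioc (0 : ℝ) 1 ⊆ z ⁻¹' G.support := by
      intro t ht
      by_contra hcon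
      obtain ⟨u, hu, hu0⟩ := Measure.notMem_support_iff_exists.1 hcon
      obtain ⟨r, hr, hru⟩ := Metric.mem_nhds_iff.1 hu
      have hball : ∀ᵐ p ∂G, p ∉ Metric.ball (z t) r :=
        measure_mono_null (fun p hp => hru (not_not.1 hp)) hu0
      have hta : 0 < t * a := mul_pos ht.1 ha.1
      -- The first bound keeps the shifted point in the square. The other two put every point of the
      -- line at most `s` to the left of `z t` into the ball, which is null, so the shifted point
      -- stays opposed to almost every signal.
      obtain ⟨s, hs, hsm⟩ : ∃ s > 0, s < min (t * a) (min r (r * β₁ / β₀)) :=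
        exists_between (lt_min hta (lt_min hr (by positivity)))
      obtain ⟨hsa, hs'⟩ := lt_min_iff.1 hsm
      obtain ⟨hsr, hsβ⟩ := lt_min_iff.1 hs'
      have htb : (1 - t) * b ∈ Set.Icc (0 : ℝ) 1 :=
        ⟨mul_nonneg (by linarith [ht.2]) hb.1.le,
          mul_le_one₀ (by linarith [ht.1]) hb.1.le hb.2⟩
      have hta1 : t * a ≤ 1 := mul_le_one₀ ht.2 ha.1.le ha.2
      have := habove ![t * a - s, (1 - t) * b] (fun j => by
          fin_cases j
          · simp only [Fin.zero_eta, Matrix.cons_val_zero]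
            exact ⟨by linarith, by linarith⟩
          · simpa using htb) (by
        filter_upwards [hball, hline, hne 0 (t * a)] with p hpb hpl hp0
        have hdiff : β₀ * (p 0 - t * a) = β₁ * ((1 - t) * b - p 1) := by
          linear_combination hpl - t * haβ - (1 - t) * hbβ
        rcases lt_or_gt_of_ne hp0 with h | h
        · left
          have h1 : (1 - t) * b < p 1 := by
            by_contra hle
            nlinarith [mul_pos hβ₀ (sub_pos.2 h), mul_nonneg hβ₁.le (sub_nonneg.2 (not_lt.1 hle))]
          have h0 : s < t * a - p 0 := by
            by_contra hle
            apply hpb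
            rw [Metric.mem_ball, dist_pi_lt_iff hr]
            intro j
            fin_cases j
            · change |p 0 - t * a| < r
              rw [abs_lt]; constructor <;> linarith
            · change |p 1 - (1 - t) * b| < r
              rw [abs_of_pos (by linarith)]
              rw [lt_div_iff₀ hβ₀] at hsβ
              by_contra hge
              nlinarith
          simp only [Matrix.cons_val_zero, Matrix.cons_val_one]
          exact ⟨by linarith, h1⟩
        · right
          have h1 : p 1 < (1 - t) * b := by
            by_contra hle
            nlinarith [mul_pos hβ₀ (sub_pos.2 h), mul_nonneg hβ₁.le (sub_nonneg.2 (not_lt.1 hle))]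
          simp only [Matrix.cons_val_zero, Matrix.cons_val_one]
          exact ⟨by linarith, h1⟩)
      simp only [Matrix.cons_val_zero, Matrix.cons_val_one] at this
      nlinarith [mul_pos hβ₀ hs, congrArg (t * ·) haβ, congrArg ((1 - t) * ·) hbβ]
    have hIcc : Set.Icc (0 : ℝ) 1 ⊆ z ⁻¹' G.support := by
      rw [← closure_Ioc (zero_ne_one (α := ℝ))]
      exact closure_minimal hIoc (Measure.isClosed_support.preimage hzc)
    rintro _ ⟨s, t, hs, ht, hst, rfl⟩
    have hmem := hIcc (show t ∈ Set.Icc (0 : ℝ) 1 from ⟨ht, by linarith⟩)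
    have e : s • ![0, b] + t • ![a, 0] = z t := by
      ext j
      fin_cases j
      · simp [hz]
      · simp [hz, ← hst]
    rw [e]
    exact hmem

/-- The support of a symmetric equilibrium of optimal welfare is a segment between the axes. -/
lemma IsEquilibrium.support_eq_segment (hv0 : v 0 = 0) (h12 : v 1 < v 2)
    (hc : v 2 < 2 * v 1) (hlam0 : 0 < lam) (hlam1 : lam < 1)
    (hG : IsEquilibrium (anonymousUtility 2 v) lam G G)
    (hwel : welfare (anonymousUtility 2 v) G G = 2 * v 1) :
    ∃ a ∈ Set.Ioc (0 : ℝ) 1, ∃ b ∈ Set.Ioc (0 : ℝ) 1,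
      G.support = segment ℝ ![0, b] ![a, 0] := by
  obtain ⟨⟨hGp, hbest⟩, -⟩ := hG
  have := hGp.isProbabilityMeasure
  have hopp := (welfare_self_eq_iff hv0 hc h12.le).1 hwel
  have hne := ae_coord_ne hopp
  set c := 2 * v 1 - v 2 with hcdef
  have hc0 : 0 ≤ c := by linarith
  have hcv : c ≤ v 1 := by linarith
  set W : (Fin 2 → ℝ) → ℝ := fun q => ∫ p, payoff (v 1) c q p ∂G with hWdef
  have hWopp : ∀ q, (∀ᵐ p ∂G, StrictlyOpposed q p) → W q = v 1 :=
    fun q hq => integral_payoff_of_opposed hq _ _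
  have hU : expectedUtility (anonymousUtility 2 v) G G = v 1 := by
    rw [welfare_self_eq_two_mul] at hwel
    linarith
  obtain ⟨α, β₀, β₁, hmaj, hval⟩ := exists_affine_majorant hlam0 hlam1 (W := W) (C := 2 * v 1)
    (M := v 1) (measurable_integral_payoff _ _)
    (fun q => integral_nonneg fun p => payoff_nonneg hc0 hcv q p)
    (fun q => by
      have := integral_mono (integrable_payoff (F := G) (v 1) c q) (integrable_const (2 * v 1))
        fun p => payoff_le_two_mul hc0 hcv q p
      simpa using this)
    (fun μ hμ => by
      have := hbest μ hμ
      rw [hU, expectedUtility_eq hv0] at this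
      exact this)
  have hi : Integrable (fun q : Fin 2 → ℝ => α + β₀ * q 0 + β₁ * q 1 - v 1) G :=
    (((integrable_const α).add ((hGp.integrable 0).const_mul β₀)).add
      ((hGp.integrable 1).const_mul β₁)).sub (integrable_const _)
  have hint : ∫ q : Fin 2 → ℝ, (α + β₀ * q 0 + β₁ * q 1 - v 1) ∂G = 0 := by
    have i1 : Integrable (fun q : Fin 2 → ℝ => α + β₀ * q 0) G :=
      (integrable_const α).add ((hGp.integrable 0).const_mul β₀)
    have i2 : Integrable (fun q : Fin 2 → ℝ => α + β₀ * q 0 + β₁ * q 1) G :=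
      i1.add ((hGp.integrable 1).const_mul β₁)
    rw [integral_sub i2 (integrable_const _), integral_add i1 ((hGp.integrable 1).const_mul β₁),
      integral_add (integrable_const α) ((hGp.integrable 0).const_mul β₀), integral_const_mul,
      integral_const_mul, hGp.bayesPlausible, hGp.bayesPlausible]
    simp
    linarith
  -- Almost every signal earns `v 1`, so the majorant is at least `v 1` almost everywhere; its mean
  -- is also `v 1`.
  have hline : ∀ᵐ q ∂G, β₀ * q 0 + β₁ * q 1 = v 1 - α := by
    have hnn : 0 ≤ᵐ[G] fun q : Fin 2 → ℝ => α + β₀ * q 0 + β₁ * q 1 - v 1 := by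
      filter_upwards [hopp, hGp.mem_cube] with q hq hqc
      have := hmaj q hqc
      rw [hWopp q hq] at this
      simpa using this
    filter_upwards [(integral_eq_zero_iff_of_nonneg_ae hnn hi).1 hint] with q hq
    simp only [Pi.zero_apply] at hq
    linarith
  have hW11 : v 1 < α + β₀ + β₁ := by
    have hw : W ![1, 1] = v 2 := by
      have : ∀ᵐ p ∂G, payoff (v 1) c ![1, 1] p = v 2 := by
        filter_upwards [hne 0 1, hne 1 1, hGp.mem_cube] with p h0 h1 hp
        simp only [payoff, Matrix.cons_val_zero, Matrix.cons_val_one]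
        rw [winProb_of_lt ((hp 0).2.lt_of_ne h0), winProb_of_lt ((hp 1).2.lt_of_ne h1), hcdef]
        ring
      rw [hWdef]
      simp only
      rw [integral_congr_ae this]
      simp
    have := hmaj ![1, 1] (fun j => by fin_cases j <;> simp)
    rw [hw] at this
    simp only [Matrix.cons_val_zero, Matrix.cons_val_one, mul_one] at this
    linarith
  obtain ⟨q, hq, hql, hqc, hq0, hq1⟩ := (hopp.and (hline.and (hGp.mem_cube.and
    ((hne 0 0).and (hne 1 0))))).exists
  obtain ⟨p, hp, hpl⟩ := (hq.and hline).exists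
  have hq0' : 0 < q 0 := (hqc 0).1.lt_of_ne' hq0
  have hq1' : 0 < q 1 := (hqc 1).1.lt_of_ne' hq1
  have hdiff : β₀ * (q 0 - p 0) = β₁ * (p 1 - q 1) := by linarith
  -- Two opposed points lie on the line, so it cannot have slopes of different sign.
  have hsign : 0 < β₀ ↔ 0 < β₁ := by
    rcases hp with ⟨h, h'⟩ | ⟨h, h'⟩
    · rw [← mul_pos_iff_of_pos_right (sub_pos.2 h), hdiff,
        mul_pos_iff_of_pos_right (sub_pos.2 h')]
    · rw [← mul_pos_iff_of_pos_right (sub_pos.2 h),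
        show β₀ * (p 0 - q 0) = β₁ * (q 1 - p 1) by linarith,
        mul_pos_iff_of_pos_right (sub_pos.2 h')]
  -- Otherwise the majorant would be no larger at `(1,1)` than at `q`, where it is `v 1`; but
  -- `(1,1)` earns `v 2 > v 1`.
  have hβ₀ : 0 < β₀ := by
    by_contra hcon
    have h1 : β₁ ≤ 0 := not_lt.1 fun h => hcon (hsign.2 h)
    nlinarith [mul_nonneg (neg_nonneg.2 h1) (sub_nonneg.2 (hqc 1).2),
      mul_nonneg (neg_nonneg.2 (not_lt.1 hcon)) (sub_nonneg.2 (hqc 0).2)]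
  have hβ₁ := hsign.1 hβ₀
  refine hGp.support_eq_segment hopp hβ₀ hβ₁ ?_ hline fun q hqc hq => ?_
  · rw [← hql]; positivity
  · have := hmaj q hqc
    rw [hWopp q hq] at this
    linarith

end Welfare

/-! ### The uniform distribution on a segment -/

section Uniform

variable {v : ℕ → ℝ} {lam : ℝ}

lemma measurable_antidiagonal (s : ℝ) : Measurable (fun t : ℝ => ![t, s - t]) := by
  refine measurable_pi_lambda _ fun j => ?_
  fin_cases j
  · exact measurable_id
  · exact measurable_const.sub measurable_id

lemma isProbabilityMeasure_cond_Icc {s : ℝ} (hs : 0 < s) :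
    IsProbabilityMeasure ((volume : Measure ℝ)[|Set.Icc 0 s]) :=
  cond_isProbabilityMeasure_of_finite (by simpa [Real.volume_Icc] using hs) (by simp)

lemma isProbabilityMeasure_uniformOnLine (h0 : 0 < lam) :
    IsProbabilityMeasure (uniformOnLine lam) := by
  have := isProbabilityMeasure_cond_Icc (s := 2 * lam) (by linarith)
  exact Measure.isProbabilityMeasure_map (measurable_antidiagonal _).aemeasurable

lemma integral_cond_Icc_id {s : ℝ} (hs : 0 < s) :
    ∫ t, t ∂((volume : Measure ℝ)[|Set.Icc 0 s]) = s / 2 := by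
  rw [ProbabilityTheory.cond, integral_smul_measure, integral_Icc_eq_integral_Ioc,
    ← intervalIntegral.integral_of_le hs.le, integral_id, Real.volume_Icc, ENNReal.toReal_inv,
    sub_zero, ENNReal.toReal_ofReal hs.le, smul_eq_mul]
  field_simp
  ring

lemma integrable_cond_Icc_id {s : ℝ} (hs : 0 < s) :
    Integrable (fun t => t) ((volume : Measure ℝ)[|Set.Icc 0 s]) := by
  have := isProbabilityMeasure_cond_Icc hs
  refine Integrable.of_bound measurable_id.aestronglyMeasurable s ?_
  filter_upwards [ae_cond_mem (μ := volume) (measurableSet_Icc (a := (0 : ℝ)) (b := s))] with t ht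
  rw [Real.norm_of_nonneg ht.1]; exact ht.2

lemma isSignalingPolicy_uniformOnLine (h0 : 0 < lam) (hlam : lam ≤ 1 / 2) :
    IsSignalingPolicy lam (uniformOnLine lam) where
  isProbabilityMeasure := isProbabilityMeasure_uniformOnLine h0
  mem_cube := by
    have hm : MeasurableSet {q : Fin 2 → ℝ | ∀ j, q j ∈ Set.Icc (0 : ℝ) 1} := by
      simp_rw [Set.ofPred_forall]
      exact MeasurableSet.iInter fun j => measurable_pi_apply j measurableSet_Icc
    rw [uniformOnLine, ae_map_iff (measurable_antidiagonal _).aemeasurable hm]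
    filter_upwards [ae_cond_mem (μ := volume)
      (measurableSet_Icc (a := (0 : ℝ)) (b := 2 * lam))] with t ht j
    fin_cases j
    · exact ⟨ht.1, ht.2.trans (by linarith)⟩
    · exact ⟨by simpa using ht.2, by simp; linarith [ht.1]⟩
  bayesPlausible j := by
    have hs : 0 < 2 * lam := by linarith
    have := isProbabilityMeasure_cond_Icc hs
    rw [uniformOnLine, integral_map (measurable_antidiagonal _).aemeasurable
      (measurable_pi_apply j).aestronglyMeasurable]
    fin_cases j
    · simp [integral_cond_Icc_id hs]
    · simp only [Fin.mk_one, Matrix.cons_val_one]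
      simp only [Matrix.cons_val_fin_one]
      rw [integral_sub (integrable_const _) (integrable_cond_Icc_id hs), integral_cond_Icc_id hs]
      simp
      ring

lemma measureReal_cond_Icc_le {s x : ℝ} (hs : 0 < s) (hx : 0 ≤ x) {A : Set ℝ} {a : ℝ}
    (hA : Set.Icc 0 s ∩ A ⊆ Set.Icc a (a + x)) :
    ((volume : Measure ℝ)[|Set.Icc 0 s]).real A ≤ x / s := by
  rw [Measure.real, cond_apply measurableSet_Icc, ENNReal.toReal_mul, ENNReal.toReal_inv,
    Real.volume_Icc, sub_zero, ENNReal.toReal_ofReal hs.le, inv_mul_eq_div]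
  refine div_le_div_of_nonneg_right (ENNReal.toReal_le_of_le_ofReal hx ?_) hs.le
  refine (measure_mono hA).trans ?_
  rw [Real.volume_Icc]; simp

/-- Both marginals are uniform on `[0, 2 * lam]`; for `q j > 2 * lam` the bound exceeds `1`. -/
lemma integral_winProb_uniformOnLine_le (h0 : 0 < lam) {q : Fin 2 → ℝ} (j : Fin 2)
    (hq : 0 ≤ q j) :
    ∫ p, winProb (q j) (p j) ∂(uniformOnLine lam) ≤ q j / (2 * lam) := by
  have hs : 0 < 2 * lam := by linarith
  have := isProbabilityMeasure_uniformOnLine h0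
  have hm : MeasurableSet {p : Fin 2 → ℝ | p j ≤ q j} := measurable_pi_apply j measurableSet_Iic
  have h1 : ∫ p, winProb (q j) (p j) ∂(uniformOnLine lam) ≤
      (uniformOnLine lam).real {p | p j ≤ q j} := by
    rw [← integral_indicator_one hm]
    exact integral_mono (integrable_winProb q j) ((integrable_const 1).indicator hm)
      fun p => winProb_le_indicator (q j) (p j)
  refine h1.trans ?_
  rw [uniformOnLine, map_measureReal_apply (measurable_antidiagonal _) hm]
  fin_cases j
  · refine measureReal_cond_Icc_le hs hq (a := 0) ?_
    rintro t ⟨ht, htq⟩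
    exact ⟨ht.1, by simpa using htq⟩
  · refine measureReal_cond_Icc_le hs hq (a := 2 * lam - q 1) ?_
    rintro t ⟨ht, htq⟩
    have : 2 * lam - t ≤ q 1 := htq
    exact ⟨by linarith, by simpa using ht.2⟩

lemma expectedUtility_uniformOnLine_le (hv0 : v 0 = 0) (h01 : 0 ≤ v 1) (hc : v 2 ≤ 2 * v 1)
    (h0 : 0 < lam) {G : Measure (Fin 2 → ℝ)} (hG : IsSignalingPolicy lam G)
    (h12 : v 1 ≤ v 2) :
    expectedUtility (anonymousUtility 2 v) G (uniformOnLine lam) ≤ v 1 := by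
  have := isProbabilityMeasure_uniformOnLine h0
  have := hG.isProbabilityMeasure
  have hc0 : 0 ≤ 2 * v 1 - v 2 := by linarith
  rw [expectedUtility_eq hv0]
  have hi : Integrable (fun q : Fin 2 → ℝ => v 1 / (2 * lam) * (q 0 + q 1)) G :=
    ((hG.integrable 0).add (hG.integrable 1)).const_mul _
  have e : ∫ q : Fin 2 → ℝ, v 1 / (2 * lam) * (q 0 + q 1) ∂G = v 1 := by
    rw [integral_const_mul, integral_add (hG.integrable 0) (hG.integrable 1),
      hG.bayesPlausible, hG.bayesPlausible]
    field_simp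
    ring
  refine le_trans (integral_mono_ae ?_ hi ?_) e.le
  · exact (integrable_payoff_prod hc0 (by linarith)).integral_prod_left
  · filter_upwards [hG.mem_cube] with q hq
    have hx := integrable_winProb (F := uniformOnLine lam) q 0
    have hy := integrable_winProb (F := uniformOnLine lam) q 1
    have h1 := integral_mono (integrable_payoff (v 1) (2 * v 1 - v 2) q)
      ((hx.add hy).const_mul (v 1)) (fun p => payoff_le hc0 q p)
    refine h1.trans ?_
    simp only [Pi.add_apply]
    rw [integral_const_mul, integral_add hx hy, div_mul_eq_mul_div, mul_div_assoc]
    refine mul_le_mul_of_nonneg_left ?_ h01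
    rw [add_div]
    exact add_le_add (integral_winProb_uniformOnLine_le h0 0 (hq 0).1)
      (integral_winProb_uniformOnLine_le h0 1 (hq 1).1)

lemma ae_strictlyOpposed_uniformOnLine :
    ∀ᵐ q ∂(uniformOnLine lam), ∀ᵐ p ∂(uniformOnLine lam), StrictlyOpposed q p := by
  have hline : ∀ᵐ q ∂(uniformOnLine lam), q 0 + q 1 = 2 * lam := by
    rw [uniformOnLine, ae_map_iff (measurable_antidiagonal _).aemeasurable
      (measurableSet_eq_fun (by fun_prop) (by fun_prop))]
    exact Filter.Eventually.of_forall fun t => by simp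
  have hne : ∀ x : ℝ, ∀ᵐ p ∂(uniformOnLine lam), p 0 ≠ x := by
    intro x
    have hm : MeasurableSet {p : Fin 2 → ℝ | p 0 ≠ x} :=
      (measurableSet_eq_fun (measurable_pi_apply 0) measurable_const).compl
    rw [uniformOnLine, ae_map_iff (measurable_antidiagonal _).aemeasurable hm]
    exact cond_absolutelyContinuous.ae_le (Measure.ae_ne volume x)
  filter_upwards [hline] with q hq
  filter_upwards [hline, hne (q 0)] with p hp hpq
  rcases lt_or_gt_of_ne hpq with h | h
  · exact Or.inl ⟨h, by linarith⟩
  · exact Or.inr ⟨h, by linarith⟩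

lemma welfare_uniformOnLine (hv0 : v 0 = 0) (h12 : v 1 ≤ v 2) (hc : v 2 < 2 * v 1)
    (h0 : 0 < lam) :
    welfare (anonymousUtility 2 v) (uniformOnLine lam) (uniformOnLine lam) = 2 * v 1 := by
  have := isProbabilityMeasure_uniformOnLine h0
  exact (welfare_self_eq_iff hv0 hc h12).2 ae_strictlyOpposed_uniformOnLine

/-- The bound `lam ≤ 1 / 2` serves only to fit the segment into the unit square. -/
lemma isEquilibrium_uniformOnLine (hv0 : v 0 = 0) (h01 : 0 ≤ v 1) (h12 : v 1 ≤ v 2)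
    (hc : v 2 < 2 * v 1) (h0 : 0 < lam) (hlam : lam ≤ 1 / 2) :
    IsEquilibrium (anonymousUtility 2 v) lam (uniformOnLine lam) (uniformOnLine lam) := by
  have h : IsBestResponse (anonymousUtility 2 v) lam (uniformOnLine lam) (uniformOnLine lam) := by
    refine ⟨isSignalingPolicy_uniformOnLine h0 hlam, fun G hG => ?_⟩
    have hw := welfare_uniformOnLine hv0 h12 hc h0
    rw [welfare_self_eq_two_mul] at hw
    have := expectedUtility_uniformOnLine_le hv0 h01 hc.le h0 hG h12
    linarith
  exact ⟨h, h⟩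

end Uniform

theorem mainTheorem2 (v : ℕ → ℝ) (hv0 : v 0 = 0) (hmono : StrictMonoOn v (Set.Iic 2))
    (hconc : IsStrictlyConcaveUpTo 2 v) (lam : ℝ) (hlam0 : 0 < lam) (hlam1 : lam < 1) :
    (lam ≤ 1 / 2 →
      priceOfStability (anonymousUtility 2 v) lam = 1 ∧
      IsEquilibrium (anonymousUtility 2 v) lam (uniformOnLine lam) (uniformOnLine lam) ∧
      welfare (anonymousUtility 2 v) (uniformOnLine lam) (uniformOnLine lam) =
        optimalWelfare (anonymousUtility 2 v)) ∧
    (1 / 2 < lam → 1 < priceOfStability (anonymousUtility 2 v) lam) ∧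
    (∀ G : Measure (Fin 2 → ℝ), IsEquilibrium (anonymousUtility 2 v) lam G G →
      welfare (anonymousUtility 2 v) G G = optimalWelfare (anonymousUtility 2 v) →
      ∃ a ∈ Set.Ioc (0 : ℝ) 1, ∃ b ∈ Set.Ioc (0 : ℝ) 1,
        G.support = segment ℝ ![0, b] ![a, 0]) ∧
    (1 / 2 < lam → ∀ G : Measure (Fin 2 → ℝ), IsSignalingPolicy lam G →
      ∀ a ∈ Set.Ioc (0 : ℝ) 1, ∀ b ∈ Set.Ioc (0 : ℝ) 1,
        ¬ G.support ⊆ segment ℝ ![0, b] ![a, 0]) := by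
  have h01 : 0 < v 1 := hv0 ▸ hmono (by simp) (by simp) zero_lt_one
  have h12 : v 1 < v 2 := hmono (by simp) (by simp) one_lt_two
  have hc : v 2 < 2 * v 1 := by
    have : v 2 - v 1 < v 1 - v 0 := hconc 0 le_rfl
    linarith
  rw [priceOfStability, optimalWelfare_eq hv0 hc.le]
  have hOPT : ENNReal.ofReal (2 * v 1) ≠ 0 := by simpa using h01
  refine ⟨fun hlam => ?_, fun hlam => ?_, fun G hG hwel => ?_, fun hlam G hG a ha b hb => ?_⟩
  · have heq := isEquilibrium_uniformOnLine hv0 h01.le h12.le hc hlam0 hlam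
    have hwel := welfare_uniformOnLine hv0 h12.le hc hlam0
    refine ⟨?_, heq, hwel⟩
    have hsup : (⨆ (G : Measure (Fin 2 → ℝ)) (_ : IsEquilibrium (anonymousUtility 2 v) lam G G),
        ENNReal.ofReal (welfare (anonymousUtility 2 v) G G)) = ENNReal.ofReal (2 * v 1) := by
      refine le_antisymm (iSup₂_le fun G hG => ENNReal.ofReal_le_ofReal ?_) ?_
      · have := hG.1.1.isProbabilityMeasure
        exact welfare_self_le hv0 hc.le h12.le
      · rw [← hwel]
        exact le_iSup₂_of_le (uniformOnLine lam) heq le_rfl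
    rw [hsup, ENNReal.div_self hOPT ENNReal.ofReal_ne_top]
  · obtain ⟨δ, hδ, hgap⟩ := exists_welfare_gap hv0 h01 h12 hc hlam hlam1
    -- The side conditions concern the constant `1`, so the supremum may be `0` and no equilibrium
    -- need exist. The gap `δ` is uniform in `G`, so the strict inequality survives the supremum.
    rw [ENNReal.lt_div_iff_mul_lt (Or.inr ENNReal.one_ne_top) (Or.inr one_ne_zero), one_mul]
    refine lt_of_le_of_lt (iSup₂_le fun G hG => ENNReal.ofReal_le_ofReal (hgap G hG)) ?_
    exact (ENNReal.ofReal_lt_ofReal_iff (by linarith)).2 (by linarith)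
  · exact hG.support_eq_segment hv0 h12 hc hlam0 hlam1 hwel
  · exact hG.not_support_subset_segment hlam ha hb
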